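/- Let $G$ be a finite simple graph that is subcubic, i.e. every vertex of $G$ has degree at most three. Let $\nu=\nu(G)$ be the matching number of $G$ (the maximum number of edges in a matching of $G$), let $c=c(G)$ be the number of connected components of $G$, and for each $i$ let $n_i$ be the number of vertices of degree $i$ in $G$. Then all five of the following inequalities hold: \begin{align*} \nu&\ge \frac{n_2}{2}+\frac{n_1}{2}-\frac{c}{2},\\ \nu&\ge \frac{n_2}{3}+\frac{2n_1}{3}-c,\\ \nu&\ge \frac{n_3}{4}+\frac{n_2}{2}+\frac{n_1}{4}-\frac{c}{2},\\ \nu&\ge \frac{7n_3}{16}+\frac{3n_2}{8}+\frac{3n_1}{16}-\frac{c}{8},\\ \nu&\ge \frac{4n_3}{9}+\frac{n_2}{3}+\frac{2n_1}{9}-\frac{c}{9}. \end{align*} -/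

import Mathlib

namespace Subcubic

/-- A finite simple graph is subcubic if its maximum degree is at most three. -/
def IsSubcubic {V : Type*} [Fintype V] (G : SimpleGraph V) [DecidableRel G.Adj] : Prop :=
  G.maxDegree ≤ 3

/-- `numDegree G i` is the number of vertices of degree `i` in `G`. -/
def numDegree {V : Type*} [Fintype V] (G : SimpleGraph V) [DecidableRel G.Adj] (i : ℕ) : ℕ :=
  (Finset.univ.filter fun v : V => G.degree v = i).card

/-- The number of connected components of `G`. -/
noncomputable def numComponents {V : Type*} (G : SimpleGraph V) : ℕ :=
  Nat.card G.ConnectedComponent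

/-- The set of all numbers of edges of matchings of `G`. -/
def matchingSizes {V : Type*} (G : SimpleGraph V) : Set ℕ :=
  {k | ∃ M : G.Subgraph, M.IsMatching ∧ M.edgeSet.ncard = k}

/-- The matching number: the maximum number of edges of a matching of `G`. -/
noncomputable def matchingNumber {V : Type*} (G : SimpleGraph V) : ℕ :=
  sSup (matchingSizes G)

/-- In a finite graph the supremum above is an attained maximum. -/
theorem isGreatest_matchingNumber {V : Type*} [Finite V] (G : SimpleGraph V) :
    IsGreatest (matchingSizes G) (matchingNumber G) := by
  have hne : (matchingSizes G).Nonempty := by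
    refine ⟨0, ⊥, ?_, ?_⟩
    · intro v hv
      simp at hv
    · simp
  have hbd : BddAbove (matchingSizes G) := by
    refine ⟨G.edgeSet.ncard, ?_⟩
    rintro k ⟨M, -, rfl⟩
    exact Set.ncard_le_ncard M.edgeSet_subset (Set.toFinite _)
  exact ⟨Nat.sSup_mem hne hbd, fun k hk => le_csSup hbd hk⟩

end Subcubic

namespace Subcubic

open SimpleGraph

/-! By Tutte–Berge some barrier S has |V| + |S| ≤ 2ν + odd(G − S), so it suffices to bound the odd
components of G − S. Let k be the number of components of G − S, D the degree sum over S, and T the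
number of edges between S and its complement. Then T ≤ D; at most c components of G − S send no edge
to S; and 2k + 2|S| ≤ 2c + D + T, since deleting an edge creates at most one new component. Inside a
component, connectivity, simplicity and the handshake identity tie its degree counts to its number
of edges to S. All five bounds are nonnegative combinations of such inequalities.
`card_le_two_mul_matchingNumber_add` carries out the combination with the multipliers as parameters,
leaving a check at one vertex of S and one in a single component. -/

theorem two_mul_ncard_edgeSet_of_isMatching {V : Type*} [Finite V] {G : SimpleGraph V}
    {M : G.Subgraph} (hM : M.IsMatching) : 2 * M.edgeSet.ncard = M.verts.ncard := by
  classical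
  have := Fintype.ofFinite V
  have h1 := M.coe.sum_degrees_eq_twice_card_edges
  have h2 : ∀ v : M.verts, M.degree v = 1 := fun v => by
    convert (Subgraph.isMatching_iff_forall_degree.1 hM) v v.2
  rw [Finset.sum_congr rfl (g := fun _ => 1)
    fun v _ => by rw [← h2 v, ← Subgraph.coe_degree]; congr!] at h1
  simp only [Finset.sum_const, Finset.card_univ, smul_eq_mul, mul_one] at h1
  have h3 : M.edgeSet.ncard = M.coe.edgeFinset.card := by
    rw [← Subgraph.image_coe_edgeSet_coe, Set.ncard_image_of_injective _
      (Sym2.map.injective Subtype.val_injective), ← coe_edgeFinset, Set.ncard_coe_finset]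
  rw [h3, ← h1, ← Nat.card_eq_fintype_card, Nat.card_coe_set_eq]

/-! ### The Tutte–Berge formula, by adding apices to reduce to Tutte's theorem -/

/-- The graph obtained from `G` by adding a set `ι` of vertices adjacent to all others. -/
def cone {V : Type*} (G : SimpleGraph V) (ι : Type*) : SimpleGraph (V ⊕ ι) where
  Adj
    | .inl v, .inl w => G.Adj v w
    | .inl _, .inr _ => True
    | .inr _, .inl _ => True
    | .inr i, .inr j => i ≠ j
  symm := ⟨by
    rintro (v | i) (w | j) h
    · exact SimpleGraph.Adj.symm (G := G) h
    · trivial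
    · trivial
    · exact Ne.symm h⟩
  loopless := ⟨by
    rintro (v | i) h
    · exact G.loopless.irrefl v h
    · exact h rfl⟩

theorem cone_adj_inr {V ι : Type*} (G : SimpleGraph V) (i : ι) (b : V ⊕ ι) (h : .inr i ≠ b) :
    (cone G ι).Adj (.inr i) b := by
  rcases b with v | j
  · trivial
  · exact fun hij => h (by rw [hij])

/-- A perfect matching of the cone over `G` restricts to a matching of `G` that misses at most
as many vertices as were added. -/
theorem card_le_of_isPerfectMatching_cone {V ι : Type*} [Finite V] [Finite ι]
    {G : SimpleGraph V} {M : (cone G ι).Subgraph} (hM : M.IsPerfectMatching) :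
    Nat.card V ≤ 2 * matchingNumber G + Nat.card ι := by
  classical
  let N : G.Subgraph :=
    { verts := {v | ∃ w, M.Adj (.inl v) (.inl w)}
      Adj := fun v w => M.Adj (.inl v) (.inl w)
      adj_sub := fun {v w} h => (M.adj_sub h : (cone G ι).Adj (.inl v) (.inl w))
      edge_vert := fun {v w} h => ⟨w, h⟩
      symm := ⟨fun v w h => Subgraph.Adj.symm (G' := M) h⟩ }
  have hN : N.IsMatching := by
    rintro v ⟨w, hw⟩
    exact ⟨w, hw, fun y hy => Sum.inl_injective (hM.1.eq_of_adj_left hy hw)⟩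
  have h1 := (isGreatest_matchingNumber G).2 ⟨N, hN, rfl⟩
  have h2 := two_mul_ncard_edgeSet_of_isMatching hN
  have h3 : N.vertsᶜ.ncard ≤ Nat.card ι := by
    have key : ∀ v : ↥(N.vertsᶜ), ∃ i : ι, M.Adj (.inl v.1) (.inr i) := by
      rintro ⟨v, hv⟩
      obtain ⟨w, hw, -⟩ := hM.1 (hM.2 (.inl v))
      rcases w with w | i
      · exact absurd ⟨w, hw⟩ hv
      · exact ⟨i, hw⟩
    choose f hf using key
    rw [← Nat.card_coe_set_eq]
    refine Nat.card_le_card_of_injective f fun a b hab => ?_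
    have := hM.1.eq_of_adj_right (hf a) (hab ▸ hf b)
    exact Subtype.ext (Sum.inl_injective this)
  have h4 := Set.ncard_add_ncard_compl N.verts
  omega

theorem ncard_oddComponents_congr {V W : Type*} {G : SimpleGraph V} {H : SimpleGraph W}
    (e : G ≃g H) : G.oddComponents.ncard = H.oddComponents.ncard := by
  have key : ∀ C : G.ConnectedComponent,
      (e.connectedComponentEquiv C).supp.ncard = C.supp.ncard := by
    intro C
    have : (e.connectedComponentEquiv C).supp = e '' C.supp := by
      ext w
      obtain ⟨v, rfl⟩ := e.surjective w
      rw [e.injective.mem_set_image]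
      induction C using ConnectedComponent.ind with | _ u =>
      simp only [ConnectedComponent.mem_supp_iff, Iso.connectedComponentEquiv_apply,
        ConnectedComponent.map_mk, ConnectedComponent.eq]
      exact Iso.reachable_iff
    rw [this, Set.ncard_image_of_injective _ e.injective]
  refine Set.ncard_congr (fun C _ => e.connectedComponentEquiv C) ?_ ?_ ?_
  · intro C hC
    simpa only [Set.mem_ofPred_eq, key] using hC
  · intro C D _ _ h
    exact e.connectedComponentEquiv.injective h
  · intro D hD
    refine ⟨e.connectedComponentEquiv.symm D, ?_, Equiv.apply_symm_apply _ _⟩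
    have := key (e.connectedComponentEquiv.symm D)
    rw [Equiv.apply_symm_apply] at this
    simpa only [Set.mem_ofPred_eq, ← this] using hD

/-- Deleting a superset of the apices from the cone over `G` is the same as deleting its trace
from `G`. -/
noncomputable def coneDeleteVertsIso {V ι : Type*} (G : SimpleGraph V) (U : Set (V ⊕ ι))
    (hU : Set.range Sum.inr ⊆ U) :
    G.induce (Sum.inl ⁻¹' U)ᶜ ≃g ((⊤ : (cone G ι).Subgraph).deleteVerts U).coe where
  toEquiv := Equiv.ofBijective (fun v => ⟨.inl v.1, trivial, v.2⟩) (by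
    constructor
    · intro a b h
      simpa [Subtype.ext_iff] using h
    · rintro ⟨v | i, h⟩
      · exact ⟨⟨v, by simpa using h⟩, rfl⟩
      · exact absurd (hU ⟨i, rfl⟩) (by simpa using h))
  map_rel_iff' := by
    rintro ⟨a, ha⟩ ⟨b, hb⟩
    have h1 : Sum.inl a ∉ U := ha
    have h2 : Sum.inl b ∉ U := hb
    have h3 : (cone G ι).Adj (.inl a) (.inl b) ↔ G.Adj a b := Iff.rfl
    change ((⊤ : (cone G ι).Subgraph).deleteVerts U).Adj (.inl a) (.inl b) ↔ G.Adj a b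
    simp [h1, h2, h3]

/-- The nontrivial direction of the Tutte–Berge formula. -/
theorem exists_card_add_card_le {V : Type*} [Finite V] (G : SimpleGraph V) :
    ∃ S : Set V, Nat.card V + S.ncard ≤
      2 * matchingNumber G + (G.induce Sᶜ).oddComponents.ncard := by
  have hempty := odd_ncard_oddComponents (G.induce (∅ : Set V)ᶜ)
  rw [Nat.card_coe_set_eq, Set.compl_empty, Set.ncard_univ, ← Set.compl_empty] at hempty
  rcases le_or_gt (Nat.card V) (2 * matchingNumber G + 1) with hsmall | hbig
  · refine ⟨∅, ?_⟩
    rw [Set.ncard_empty]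
    rcases Nat.even_or_odd (Nat.card V) with ⟨r, hr⟩ | ho
    · omega
    · have := (hempty.2 ho).pos
      omega
  -- Two apices fewer than the deficiency |V| − 2ν, so the cone has no perfect matching.
  obtain ⟨d, hd⟩ : ∃ d, Nat.card V = 2 * matchingNumber G + 2 + d :=
    ⟨_, (Nat.add_sub_of_le hbig).symm⟩
  have hno : ¬ ∃ M : (cone G (Fin d)).Subgraph, M.IsPerfectMatching := by
    rintro ⟨M, hM⟩
    have := card_le_of_isPerfectMatching_cone hM
    rw [Nat.card_fin] at this
    omega
  rw [tutte] at hno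
  push Not at hno
  obtain ⟨U, hU⟩ := hno
  rw [IsTutteViolator] at hU
  have hpar := odd_ncard_oddComponents ((⊤ : (cone G (Fin d)).Subgraph).deleteVerts U).coe
  have hcard : Nat.card ↥((⊤ : (cone G (Fin d)).Subgraph).deleteVerts U).verts + U.ncard
      = Nat.card V + d := by
    rw [Nat.card_coe_set_eq, Subgraph.deleteVerts_verts, Subgraph.verts_top,
      ← Set.compl_eq_univ_sdiff, add_comm, Set.ncard_add_ncard_compl, Nat.card_sum, Nat.card_fin]
  rw [Nat.odd_iff, Nat.odd_iff] at hpar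
  -- The cone has 2ν + 2 + 2d vertices, an even number, so a violator has excess at least two.
  have hU2 : U.ncard + 2 ≤
      ((⊤ : (cone G (Fin d)).Subgraph).deleteVerts U).coe.oddComponents.ncard := by
    omega
  by_cases hr : Set.range Sum.inr ⊆ U
  · refine ⟨Sum.inl ⁻¹' U, ?_⟩
    rw [ncard_oddComponents_congr (coneDeleteVertsIso G U hr)]
    have : U.ncard = (Sum.inl ⁻¹' U : Set V).ncard + d := by
      have e : U = Sum.inl '' (Sum.inl ⁻¹' U) ∪ Set.range Sum.inr := by
        ext (v | i)
        · simp
        · simpa using hr ⟨i, rfl⟩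
      conv_lhs => rw [e]
      rw [Set.ncard_union_eq (by
        rw [Set.disjoint_left]
        rintro _ ⟨v, -, rfl⟩ ⟨i, h⟩
        cases h), Set.ncard_image_of_injective _ Sum.inl_injective, ← Set.image_univ,
        Set.ncard_image_of_injective _ Sum.inr_injective, Set.ncard_univ, Nat.card_fin]
    omega
  · exfalso
    rw [Set.not_subset] at hr
    obtain ⟨_, ⟨i, rfl⟩, hi⟩ := hr
    -- A surviving apex is adjacent to everything, leaving one component where at least two are
    -- needed.
    have hconn : ((⊤ : (cone G (Fin d)).Subgraph).deleteVerts U).coe.Connected := by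
      refine Connected.of_isUniversal (v := ⟨.inr i, by simpa using hi⟩) ?_
      rintro ⟨b, hb⟩ hne
      have hb' : b ∉ U := by simpa using hb
      have := cone_adj_inr G i b (fun h => hne (Subtype.ext h))
      simp [Subgraph.deleteVerts, hi, hb', this]
    have := hconn.preconnected.subsingleton_connectedComponent
    have := Set.ncard_le_one_of_subsingleton
      ((⊤ : (cone G (Fin d)).Subgraph).deleteVerts U).coe.oddComponents
    omega

/-! ### Components under deletion of edges and vertices -/

theorem eq_of_reachable {V X : Type*} {G : SimpleGraph V} {f : V → X}
    (h : ∀ u v, G.Adj u v → f u = f v) {u v : V} (huv : G.Reachable u v) : f u = f v := by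
  obtain ⟨p⟩ := huv
  induction p with
  | nil => rfl
  | cons hadj _ ih => exact (h _ _ hadj).trans ih

/-- A function that is constant on edges takes at most as many values as there are components. -/
theorem ncard_le_numComponents {V X : Type*} [Finite V] {G : SimpleGraph V} (f : V → X)
    (h : ∀ u v, G.Adj u v → f u = f v) {A : Set X} (hA : A ⊆ Set.range f) :
    A.ncard ≤ numComponents G := by
  let g : G.ConnectedComponent → X := ConnectedComponent.lift f fun u v p _ =>
    eq_of_reachable h p.reachable
  have hg : A ⊆ g '' Set.univ := by
    intro x hx
    obtain ⟨v, rfl⟩ := hA hx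
    exact ⟨G.connectedComponentMk v, trivial, rfl⟩
  refine (Set.ncard_le_ncard hg (Set.toFinite _)).trans ((Set.ncard_image_le).trans ?_)
  rw [Set.ncard_univ, numComponents]

/-- Redirecting the component of `u` to that of `v` makes the component map of `G'` constant on
edges of `G`; its range still contains every component other than that of `u`. -/
theorem numComponents_deleteEdges_singleton_le {V : Type*} [Finite V] (G : SimpleGraph V)
    (e : Sym2 V) : numComponents (G.deleteEdges {e}) ≤ numComponents G + 1 := by
  classical
  induction e with | _ u v =>
  set G' := G.deleteEdges {s(u, v)} with hG'
  have key : ({G'.connectedComponentMk u}ᶜ : Set G'.ConnectedComponent).ncard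
      ≤ numComponents G := by
    refine ncard_le_numComponents (fun x => if G'.connectedComponentMk x = G'.connectedComponentMk u
      then G'.connectedComponentMk v else G'.connectedComponentMk x) ?_ ?_
    · intro x y hxy
      by_cases he : s(x, y) = s(u, v)
      · rcases Sym2.eq_iff.1 he with ⟨rfl, rfl⟩ | ⟨rfl, rfl⟩ <;> simp
      · have : G'.Adj x y := by simpa [hG', deleteEdges_adj, hxy] using he
        simp only [ConnectedComponent.connectedComponentMk_eq_of_adj this]
    · intro C hC
      obtain ⟨x, rfl⟩ := C.exists_rep
      exact ⟨x, if_neg hC⟩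
  have := Set.ncard_add_ncard_compl ({G'.connectedComponentMk u} : Set G'.ConnectedComponent)
  rw [Set.ncard_singleton] at this
  rw [numComponents]
  omega

/-- Deleting edges increases the number of components by at most the number of edges deleted. -/
theorem numComponents_le_add {V : Type*} [Finite V] {H : SimpleGraph V} (n : ℕ) :
    ∀ {G : SimpleGraph V}, H ≤ G → G.edgeSet.ncard = H.edgeSet.ncard + n →
      numComponents H ≤ numComponents G + n := by
  induction n with
  | zero =>
    intro G hle hn
    have := Set.eq_of_subset_of_ncard_le (edgeSet_mono hle) hn.le (Set.toFinite _)
    rw [edgeSet_inj.1 this]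
    exact le_rfl
  | succ n ih =>
    intro G hle hn
    obtain ⟨e, heG, heH⟩ := Set.exists_mem_notMem_of_ncard_lt_ncard
      (s := H.edgeSet) (t := G.edgeSet) (by omega) (Set.toFinite _)
    have h1 := numComponents_deleteEdges_singleton_le G e
    have h2 : H ≤ G.deleteEdges {e} := by
      rw [← edgeSet_subset_edgeSet, edgeSet_deleteEdges]
      exact Set.subset_sdiff_singleton (edgeSet_mono hle) heH
    have h3 := Set.ncard_sdiff_singleton_add_one heG (Set.toFinite _)
    have := ih h2 (by rw [edgeSet_deleteEdges]; omega)
    omega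

theorem sum_degree_eq {V : Type*} [Fintype V] (G : SimpleGraph V) [DecidableRel G.Adj] :
    ∑ v, G.degree v = 2 * G.edgeSet.ncard := by
  classical
  rw [G.sum_degrees_eq_twice_card_edges, ← coe_edgeFinset, Set.ncard_coe_finset]

/-- Deleting the vertices of `S` creates components at the expense of the deleted edges. -/
theorem numComponents_induce_compl_le {V : Type*} [Finite V] (G : SimpleGraph V) (S : Set V) :
    numComponents (G.induce Sᶜ) + S.ncard + (G.induce Sᶜ).edgeSet.ncard ≤
      numComponents G + G.edgeSet.ncard := by
  classical
  set K := G.induce Sᶜ with hK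
  -- `H` is `K` with the vertices of `S` restored as isolated points, hence `G` with edges deleted.
  let H : SimpleGraph V := K.map (Function.Embedding.subtype _)
  have hle : H ≤ G := spanningCoe_induce_le G Sᶜ
  have hE : H.edgeSet.ncard = K.edgeSet.ncard := by
    rw [edgeSet_map, Set.ncard_image_of_injective _ (Function.Embedding.injective _)]
  have hsub := Set.ncard_le_ncard (edgeSet_mono hle) (Set.toFinite _)
  have h1 := numComponents_le_add (G.edgeSet.ncard - H.edgeSet.ncard) hle (by omega)
  have h2 : (Set.univ : Set (K.ConnectedComponent ⊕ S)).ncard ≤ numComponents H := by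
    refine ncard_le_numComponents
      (fun v => if h : v ∈ S then .inr ⟨v, h⟩ else .inl (K.connectedComponentMk ⟨v, h⟩)) ?_ ?_
    · rintro _ _ ⟨-, u, v, huv, rfl, rfl⟩
      have hu : (u : V) ∉ S := u.2
      have hv : (v : V) ∉ S := v.2
      simp [hu, hv, ConnectedComponent.connectedComponentMk_eq_of_adj huv]
    · rintro (C | s) -
      · obtain ⟨⟨x, hx⟩, rfl⟩ := C.exists_rep
        have hx' : x ∉ S := hx
        exact ⟨x, dif_neg hx'⟩
      · exact ⟨s, dif_pos s.2⟩
  rw [Set.ncard_univ, Nat.card_sum, Nat.card_coe_set_eq] at h2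
  change numComponents K + S.ncard ≤ numComponents H at h2
  omega

/-! ### Degree counts and the duality inequality -/

/-- The edge count of a connected component, compared with its number of vertices. -/
theorem ConnectedComponent.exists_sum_degree_eq {W : Type*} [Fintype W] [DecidableEq W]
    {K : SimpleGraph W} [DecidableRel K.Adj] [DecidableEq K.ConnectedComponent]
    (C : K.ConnectedComponent) : ∃ m : ℕ,
      ∑ v with K.connectedComponentMk v = C, K.degree v = 2 * m ∧
      C.supp.ncard ≤ m + 1 ∧ m ≤ C.supp.ncard.choose 2 := by
  classical
  have hc := C.connected_toSimpleGraph
  refine ⟨C.toSimpleGraph.edgeSet.ncard, ?_, ?_, ?_⟩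
  · have hdeg : ∀ v : C.supp, K.degree v = C.toSimpleGraph.degree v := by
      intro v
      symm
      have hsub : K.neighborSet v ⊆ C.supp := fun w hw => (C.mem_supp_congr_adj hw).1 v.2
      rw [← degree_induce_of_neighborSet_subset hsub]
      congr!
    refine Eq.trans ?_ (sum_degree_eq C.toSimpleGraph)
    rw [Finset.sum_subtype (p := (· ∈ C.supp)) _ (by simp), Finset.sum_congr rfl fun v _ => hdeg v]
    congr!
  · have := hc.card_vert_le_card_edgeSet_add_one
    rwa [Nat.card_coe_set_eq] at this
  · have := C.toSimpleGraph.card_edgeFinset_le_card_choose_two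
    rw [← Set.ncard_coe_finset, coe_edgeFinset, ← Nat.card_eq_fintype_card] at this
    exact this

theorem sum_weight_degree_eq {V : Type*} [Fintype V] (G : SimpleGraph V)
    [DecidableRel G.Adj] (hG : ∀ v, G.degree v ≤ 3) (w : ℕ → ℝ) :
    ∑ v, w (G.degree v) = w 0 * numDegree G 0 + w 1 * numDegree G 1 + w 2 * numDegree G 2
      + w 3 * numDegree G 3 := by
  have : ∀ v, w (G.degree v) = w 0 * (if G.degree v = 0 then 1 else 0)
      + w 1 * (if G.degree v = 1 then 1 else 0) + w 2 * (if G.degree v = 2 then 1 else 0)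
      + w 3 * (if G.degree v = 3 then 1 else 0) := by
    intro v
    have := hG v
    generalize G.degree v = d at *
    interval_cases d <;> simp
  simp only [this, Finset.sum_add_distrib, ← Finset.mul_sum, numDegree, Finset.sum_boole]

/-- Linear programming duality between degree counts and the matching number: `w` weighs the
vertices by degree, `μ` and `ρ` the components of `G`, and `θ` the edges leaving a component of
`G` minus a Tutte–Berge barrier. -/
theorem card_le_two_mul_matchingNumber_add {V : Type*} [Fintype V] (G : SimpleGraph V)
    [DecidableRel G.Adj] (hG : ∀ v, G.degree v ≤ 3) (w : ℕ → ℝ) (μ θ ρ : ℝ) (hμ : 0 ≤ μ)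
    (hρ : 0 ≤ ρ) (hμθ : 0 ≤ μ + 2 * θ) (hS : ∀ d ≤ 3, (μ + θ) * (d : ℕ) ≤ 1 + μ + w d)
    (hC : ∀ n₀ n₁ n₂ n₃ e m : ℕ, 1 ≤ n₀ + n₁ + n₂ + n₃ → n₀ + n₁ + n₂ + n₃ ≤ m + 1 →
      m ≤ (n₀ + n₁ + n₂ + n₃).choose 2 → 2 * m + e = n₁ + 2 * n₂ + 3 * n₃ →
      (if Odd (n₀ + n₁ + n₂ + n₃) then 1 else 0 : ℝ) ≤ w 0 * n₀ + w 1 * n₁ + w 2 * n₂ + w 3 * n₃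
        + μ + θ * e + if e = 0 then ρ else 0) :
    (Fintype.card V : ℝ) ≤ 2 * matchingNumber G + (w 0 * numDegree G 0 + w 1 * numDegree G 1
      + w 2 * numDegree G 2 + w 3 * numDegree G 3) + (μ + ρ) * numComponents G := by
  classical
  obtain ⟨S, hTB⟩ := exists_card_add_card_le G
  set K := G.induce Sᶜ with hK
  -- `e v` counts the edges from `v` to `S`, and `E C` those leaving `C`.
  let e : ↥Sᶜ → ℕ := fun v => ∑ u : S, if G.Adj v u then 1 else 0
  let cs : K.ConnectedComponent → Finset ↥Sᶜ := fun C =>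
    Finset.univ.filter fun v => K.connectedComponentMk v = C
  let E : K.ConnectedComponent → ℕ := fun C => ∑ v ∈ cs C, e v
  have hsplitN : ∀ f : V → ℕ, ∑ v, f v = ∑ v : S, f v + ∑ v : ↥Sᶜ, f v := fun f =>
    (Fintype.sum_subtype_add_sum_subtype (· ∈ S) f).symm
  have hsplit : ∀ f : V → ℝ, ∑ v, f v = ∑ v : S, f v + ∑ v : ↥Sᶜ, f v := fun f =>
    (Fintype.sum_subtype_add_sum_subtype (· ∈ S) f).symm
  have hdegsum : ∀ v, G.degree v = ∑ u, if G.Adj v u then 1 else 0 := fun v => by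
    rw [← card_neighborFinset_eq_degree, neighborFinset_eq_filter, Finset.card_filter]
  have hdeg : ∀ v : ↥Sᶜ, G.degree v = K.degree v + e v := fun v => by
    have hk : K.degree v = ∑ u : ↥Sᶜ, if G.Adj v u then 1 else 0 := by
      rw [← card_neighborFinset_eq_degree, neighborFinset_eq_filter, Finset.card_filter]
      simp [hK]
    rw [hdegsum, hsplitN, hk, add_comm]
  have hT : ∑ v, e v ≤ ∑ s : S, G.degree s := by
    rw [Finset.sum_comm]
    refine Finset.sum_le_sum fun s _ => ?_
    rw [hdegsum, hsplitN]
    simp only [G.adj_comm s]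
    omega
  have hET : ∑ C, E C = ∑ v, e v := Finset.sum_fiberwise _ _ _
  have hB : 2 * numComponents K + 2 * S.ncard ≤
      2 * numComponents G + (∑ s : S, G.degree s + ∑ v, e v) := by
    have h1 := numComponents_induce_compl_le G S
    have h2 := sum_degree_eq G
    have h3 := sum_degree_eq K
    rw [hsplitN, Finset.sum_congr rfl fun v _ => hdeg v, Finset.sum_add_distrib] at h2
    rw [← hK] at h1
    omega
  have hZ : (Finset.univ.filter fun C => E C = 0).card ≤ numComponents G := by
    have hadj : ∀ u v : V, G.Adj u v → ∀ (hu : u ∈ Sᶜ) (C : K.ConnectedComponent), E C = 0 →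
        K.connectedComponentMk ⟨u, hu⟩ = C →
        ∃ hv : v ∈ Sᶜ, K.connectedComponentMk ⟨v, hv⟩ = C := by
      intro u v huv hu C hE hmk
      have hv : v ∈ Sᶜ := by
        intro hv
        have h1 := Finset.sum_eq_zero_iff.1 hE ⟨u, hu⟩ (by simp [cs, hmk])
        have h2 := Finset.sum_eq_zero_iff.1 h1 ⟨v, hv⟩ (Finset.mem_univ _)
        simp [huv] at h2
      refine ⟨hv, hmk ▸ ConnectedComponent.connectedComponentMk_eq_of_adj ?_⟩
      exact huv.symm
    -- A component with `E C = 0` is closed under adjacency in `G`, so recording which such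
    -- component contains `x`, if any, is constant on edges.
    have hf : ∀ u v : V, G.Adj u v →
        (fun x (C : K.ConnectedComponent) =>
          E C = 0 ∧ ∃ hx : x ∈ Sᶜ, K.connectedComponentMk ⟨x, hx⟩ = C) u =
        (fun x (C : K.ConnectedComponent) =>
          E C = 0 ∧ ∃ hx : x ∈ Sᶜ, K.connectedComponentMk ⟨x, hx⟩ = C) v := by
      intro u v huv
      funext C
      refine propext (and_congr_right fun hE => ⟨?_, ?_⟩)
      · rintro ⟨hu, h⟩
        exact hadj u v huv hu C hE h
      · rintro ⟨hv, h⟩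
        exact hadj v u huv.symm hv C hE h
    have hinj : Function.Injective (fun D C : K.ConnectedComponent => D = C) := by
      intro C D h
      exact ((congrFun h C).mp rfl).symm
    have h := ncard_le_numComponents _ hf
      (A := (fun D C : K.ConnectedComponent => D = C) '' {C | E C = 0}) (by
        rintro _ ⟨D, hD, rfl⟩
        obtain ⟨⟨x, hx⟩, rfl⟩ := D.exists_rep
        refine ⟨x, ?_⟩
        funext C
        refine propext ⟨fun ⟨_, _, h⟩ => h, ?_⟩
        rintro rfl
        exact ⟨hD, hx, rfl⟩)
    rw [Set.ncard_image_of_injective _ hinj] at h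
    rw [← Set.ncard_coe_finset]
    simpa using h
  have hcomp : ∀ C, (if Odd C.supp.ncard then 1 else 0 : ℝ) ≤
      ∑ v ∈ cs C, w (G.degree v) + μ + θ * E C + if E C = 0 then ρ else 0 := by
    intro C
    obtain ⟨m, hm, hm1, hm2⟩ := ConnectedComponent.exists_sum_degree_eq C
    let n : ℕ → ℕ := fun i => ((cs C).filter fun v : ↥Sᶜ => G.degree (v : V) = i).card
    have hcard : C.supp.ncard = (cs C).card := by
      rw [← Set.ncard_coe_finset]
      congr 1
      ext v
      simp [cs]
    have hpos : 1 ≤ C.supp.ncard := (Set.ncard_pos (Set.toFinite _)).2 C.nonempty_supp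
    have hn : (cs C).card = n 0 + n 1 + n 2 + n 3 := by
      simp only [n, Finset.card_filter, ← Finset.sum_add_distrib]
      rw [Finset.card_eq_sum_ones]
      refine Finset.sum_congr rfl fun v _ => ?_
      have := hG v
      generalize G.degree (v : V) = d at *
      interval_cases d <;> simp
    have hd : ∑ v ∈ cs C, G.degree (v : V) = n 1 + 2 * n 2 + 3 * n 3 := by
      simp only [n, Finset.card_filter, Finset.mul_sum, ← Finset.sum_add_distrib]
      refine Finset.sum_congr rfl fun v _ => ?_
      have := hG v
      generalize G.degree (v : V) = d at *
      interval_cases d <;> simp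
    have hw : ∑ v ∈ cs C, w (G.degree (v : V)) =
        w 0 * n 0 + w 1 * n 1 + w 2 * n 2 + w 3 * n 3 := by
      simp only [n, Finset.card_filter, Nat.cast_sum, Finset.mul_sum, ← Finset.sum_add_distrib]
      refine Finset.sum_congr rfl fun v _ => ?_
      have := hG v
      generalize G.degree (v : V) = d at *
      interval_cases d <;> simp
    have hme : 2 * m + E C = n 1 + 2 * n 2 + 3 * n 3 := by
      rw [← hd, Finset.sum_congr rfl fun v _ => hdeg v, Finset.sum_add_distrib, hm]
    rw [hcard, hn] at hpos hm1 hm2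
    rw [hcard, hn, hw]
    exact hC _ _ _ _ _ _ hpos hm1 hm2 hme
  have hsum := Finset.sum_le_sum fun C (_ : C ∈ Finset.univ) => hcomp C
  have hodd : (∑ C : K.ConnectedComponent, if Odd C.supp.ncard then 1 else 0 : ℝ)
      = K.oddComponents.ncard := by
    rw [Finset.sum_boole, ← Set.ncard_coe_finset]
    simp
  have hcsum : ∑ C, ∑ v ∈ cs C, w (G.degree (v : V)) = ∑ v : ↥Sᶜ, w (G.degree (v : V)) :=
    Finset.sum_fiberwise _ _ _
  have hzero : (∑ C, if E C = 0 then ρ else 0) =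
      ρ * (Finset.univ.filter fun C => E C = 0).card := by
    rw [← Finset.sum_filter, Finset.sum_const, nsmul_eq_mul, mul_comm]
  have hEr : ∑ C, (E C : ℝ) = ((∑ v, e v : ℕ) : ℝ) := by
    rw [← hET, Nat.cast_sum]
  rw [hodd] at hsum
  simp only [Finset.sum_add_distrib, ← Finset.mul_sum] at hsum
  rw [hcsum, hzero, hEr, Finset.sum_const, Finset.card_univ, nsmul_eq_mul,
    ← Nat.card_eq_fintype_card] at hsum
  have hSsum : (μ + θ) * ((∑ s : S, G.degree s : ℕ) : ℝ) ≤
      (1 + μ) * S.ncard + ∑ s : S, w (G.degree s) := by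
    have := Finset.sum_le_sum fun (s : S) (_ : s ∈ Finset.univ) => hS _ (hG s)
    rw [← Finset.mul_sum, Finset.sum_add_distrib, Finset.sum_const, Finset.card_univ,
      nsmul_eq_mul, ← Nat.card_eq_fintype_card, Nat.card_coe_set_eq] at this
    rw [Nat.cast_sum]
    linarith
  rw [← sum_weight_degree_eq G hG w, hsplit]
  rw [Nat.card_eq_fintype_card] at hTB
  have hTB' : (Fintype.card V : ℝ) + S.ncard ≤ 2 * matchingNumber G + K.oddComponents.ncard := by
    exact_mod_cast hTB
  have hB' : 2 * (Nat.card K.ConnectedComponent : ℝ) + 2 * S.ncard ≤ 2 * numComponents G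
      + ((∑ s : S, G.degree s : ℕ) + (∑ v, e v : ℕ)) := by
    exact_mod_cast hB
  have hT' : ((∑ v, e v : ℕ) : ℝ) ≤ (∑ s : S, G.degree s : ℕ) := by exact_mod_cast hT
  have hZ' : ((Finset.univ.filter fun C => E C = 0).card : ℝ) ≤ numComponents G := by
    exact_mod_cast hZ
  -- Half of `p1` and `p2` plus `p3` eliminates k, T and the components without outgoing edges;
  -- `hSsum` absorbs D.
  have p1 := mul_le_mul_of_nonneg_left hB' hμ
  have p2 := mul_le_mul_of_nonneg_left hT' hμθ
  have p3 := mul_le_mul_of_nonneg_left hZ' hρ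
  linarith

end Subcubic

/-! ### The five choices of multipliers -/

theorem theorem3 {V : Type*} [Fintype V] (G : SimpleGraph V) [DecidableRel G.Adj]
    (hG : Subcubic.IsSubcubic G) :
    (Subcubic.matchingNumber G : ℝ) ≥
        (Subcubic.numDegree G 2 : ℝ) / 2 + (Subcubic.numDegree G 1 : ℝ) / 2
          - (Subcubic.numComponents G : ℝ) / 2 ∧
    (Subcubic.matchingNumber G : ℝ) ≥
        (Subcubic.numDegree G 2 : ℝ) / 3 + 2 * (Subcubic.numDegree G 1 : ℝ) / 3
          - (Subcubic.numComponents G : ℝ) ∧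
    (Subcubic.matchingNumber G : ℝ) ≥
        (Subcubic.numDegree G 3 : ℝ) / 4 + (Subcubic.numDegree G 2 : ℝ) / 2
          + (Subcubic.numDegree G 1 : ℝ) / 4 - (Subcubic.numComponents G : ℝ) / 2 ∧
    (Subcubic.matchingNumber G : ℝ) ≥
        7 * (Subcubic.numDegree G 3 : ℝ) / 16 + 3 * (Subcubic.numDegree G 2 : ℝ) / 8
          + 3 * (Subcubic.numDegree G 1 : ℝ) / 16 - (Subcubic.numComponents G : ℝ) / 8 ∧
    (Subcubic.matchingNumber G : ℝ) ≥
        4 * (Subcubic.numDegree G 3 : ℝ) / 9 + (Subcubic.numDegree G 2 : ℝ) / 3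
          + 2 * (Subcubic.numDegree G 1 : ℝ) / 9 - (Subcubic.numComponents G : ℝ) / 9 := by
  have hdeg : ∀ v, G.degree v ≤ 3 := fun v => (G.degree_le_maxDegree v).trans hG
  have hcard : (Fintype.card V : ℝ) = Subcubic.numDegree G 0 + Subcubic.numDegree G 1
      + Subcubic.numDegree G 2 + Subcubic.numDegree G 3 := by
    simpa using Subcubic.sum_weight_degree_eq G hdeg fun _ => 1
  -- In the last two bounds, simplicity matters only for components with one or three vertices.
  have hchoose : ∀ s m : ℕ, m ≤ s.choose 2 → (s = 1 → m = 0) ∧ (s = 3 → m ≤ 3) := by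
    rintro s m h
    constructor <;> rintro rfl <;> simpa using h
  -- weights for degrees `0, 1, 2, 3`
  let W : ℝ → ℝ → ℝ → ℕ → ℝ := fun a b c d =>
    if d = 0 then 1 else if d = 1 then a else if d = 2 then b else c
  -- A coefficient a of n_d forces `w d = 1 - 2a`, and a term −b·c forces `μ + ρ = 2b`.
  refine ⟨?_, ?_, ?_, ?_, ?_⟩
  · have h := Subcubic.card_le_two_mul_matchingNumber_add G hdeg (W 0 0 1) 1 0 0
      (by norm_num) (by norm_num) (by norm_num)
      (by intro d hd; interval_cases d <;> norm_num [W])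
      (by
        intro n₀ n₁ n₂ n₃ e m _ _ _ _
        have : (if Odd (n₀ + n₁ + n₂ + n₃) then 1 else 0 : ℝ) ≤ 1 := by split_ifs <;> norm_num
        simp only [W]
        norm_num
        linarith [Nat.cast_nonneg (α := ℝ) n₀, Nat.cast_nonneg (α := ℝ) n₃])
    norm_num [W] at h
    linarith
  · have h := Subcubic.card_le_two_mul_matchingNumber_add G hdeg (W (-1/3) (1/3) 1) 2 (-2/3) 0
      (by norm_num) (by norm_num) (by norm_num)
      (by intro d hd; interval_cases d <;> norm_num [W])
      (by
        intro n₀ n₁ n₂ n₃ e m h1 h2 _ h4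
        have : (if Odd (n₀ + n₁ + n₂ + n₃) then 1 else 0 : ℝ) ≤ 1 := by split_ifs <;> norm_num
        simp only [W]
        norm_num
        -- As θ is negative, `e` must be bounded above: this is connectivity, `m ≥ s - 1` for s
        -- vertices, together with `s ≥ 1`.
        have h5 : 2 * e + n₁ ≤ 3 + 3 * n₀ + n₂ + 3 * n₃ := by omega
        have h6 : (2 * e + n₁ : ℝ) ≤ 3 + 3 * n₀ + n₂ + 3 * n₃ := by exact_mod_cast h5
        linarith)
    norm_num [W] at h
    linarith
  · have h := Subcubic.card_le_two_mul_matchingNumber_add G hdeg (W (1/2) 0 (1/2)) 0 (1/2) 1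
      (by norm_num) (by norm_num) (by norm_num)
      (by intro d hd; interval_cases d <;> norm_num [W])
      (by
        intro n₀ n₁ n₂ n₃ e m h1 h2 h3 h4
        -- If `e = 1`, the degree sum is odd, so a vertex of odd degree supplies the missing unit.
        have h5 : (if Odd (n₀ + n₁ + n₂ + n₃) then 2 else 0) ≤
            2 * n₀ + n₁ + n₃ + e + if e = 0 then 2 else 0 := by
          split_ifs <;> grind
        have h6 : (if Odd (n₀ + n₁ + n₂ + n₃) then 2 else 0 : ℝ) ≤
            2 * n₀ + n₁ + n₃ + e + if e = 0 then 2 else 0 := by exact_mod_cast h5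
        simp only [W]
        norm_num
        split_ifs at h6 ⊢ <;> linarith)
    norm_num [W] at h
    linarith
  · have h := Subcubic.card_le_two_mul_matchingNumber_add G hdeg (W (5/8) (1/4) (1/8)) 0 (3/8)
      (1/4) (by norm_num) (by norm_num) (by norm_num)
      (by intro d hd; interval_cases d <;> norm_num [W])
      (by
        intro n₀ n₁ n₂ n₃ e m h1 h2 h3 h4
        have h3' := hchoose _ _ h3
        -- For `e = 0`, equality occurs at three vertices of degree two, and at one of degree two
        -- with four of degree three.
        have h5 : (if Odd (n₀ + n₁ + n₂ + n₃) then 8 else 0) ≤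
            8 * n₀ + 5 * n₁ + 2 * n₂ + n₃ + 3 * e + if e = 0 then 2 else 0 := by
          split_ifs with ho he he
          · obtain ⟨r, hr⟩ := ho
            omega
          · obtain ⟨r, hr⟩ := ho
            omega
          · omega
          · omega
        have h6 : (if Odd (n₀ + n₁ + n₂ + n₃) then 8 else 0 : ℝ) ≤
            8 * n₀ + 5 * n₁ + 2 * n₂ + n₃ + 3 * e + if e = 0 then 2 else 0 := by
          exact_mod_cast h5
        simp only [W]
        norm_num
        split_ifs at h6 ⊢ <;> linarith)
    norm_num [W] at h
    linarith
  · have h := Subcubic.card_le_two_mul_matchingNumber_add G hdeg (W (5/9) (1/3) (1/9)) (2/9) (2/9)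
      0 (by norm_num) (by norm_num) (by norm_num)
      (by intro d hd; interval_cases d <;> norm_num [W])
      (by
        intro n₀ n₁ n₂ n₃ e m h1 h2 h3 h4
        have h3' := hchoose _ _ h3
        -- Equality occurs at one cubic vertex with `e = 3` and at five cubic vertices with `e = 1`;
        -- parity rules out `e = 0` in the latter case.
        have h5 : (if Odd (n₀ + n₁ + n₂ + n₃) then 9 else 0) ≤
            9 * n₀ + 5 * n₁ + 3 * n₂ + n₃ + 2 + 2 * e := by
          split_ifs with ho
          · obtain ⟨r, hr⟩ := ho
            omega
          · omega
        have h6 : (if Odd (n₀ + n₁ + n₂ + n₃) then 9 else 0 : ℝ) ≤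
            9 * n₀ + 5 * n₁ + 3 * n₂ + n₃ + 2 + 2 * e := by
          exact_mod_cast h5
        simp only [W]
        norm_num
        split_ifs at h6 ⊢ <;> linarith)
    norm_num [W] at h
    linarith
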